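/- Let $G$ be a finite connected bipartite simple graph with $n$ vertices, and let $T$ be a spanning tree of $G$. A partial orientation $\sigma$ of $G$ with respect to $T$ orients every edge of $G$ that is not in $T$ and leaves the edges of $T$ unoriented; it is encoded by a skew-symmetric map $\sigma$ with values in $\{0,1,-1\}$, where, for $\{u,v\}\in E(G)\setminus E(T)$, $\sigma(u,v)=1$ if the edge is oriented from $u$ to $v$ and $\sigma(u,v)=-1$ if it is oriented from $v$ to $u$. Let $G_T^\sigma$ be the resulting mixed graph. Its Hermitian adjacency matrix $H(G_T^\sigma)=(h_{uv})$ is given by $h_{uv}=1$ if $\{u,v\}\in E(T)$, $h_{uv}=\mathrm{i}\,\sigma(u,v)$ if $\{u,v\}\in E(G)\setminus E(T)$, and $h_{uv}=0$ otherwise, and its spectral radius $\rho(G_T^\sigma)$ is the largest modulus of an eigenvalue of $H(G_T^\sigma)$. Let $$\mu_G(x)=\sum_{k\ge 0}(-1)^k m_k(G)\,x^{n-2k}$$ be the matching polynomial of $G$, where $m_k(G)$ is the number of matchings of $G$ with exactly $k$ edges, and let $\rho(\mu_G)$ be the largest absolute value of the complex roots of $\mu_G$. Then $\rho(\mu_G)$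 is itself a root of $\mu_G$, hence its largest real root, and there exists a partial orientation $\sigma$ of $G$ with respect to $T$ such that $$\rho(G_T^\sigma)\le\rho(\mu_G).$$ -/

import Mathlib

/-- A set `M` of edges of `G` is a matching if its edges are pairwise non-adjacent,
that is, no two distinct edges of `M` share a vertex. -/
def IsEdgeMatching {V : Type*} (G : SimpleGraph V) (M : Finset (Sym2 V)) : Prop :=
  (∀ e ∈ M, e ∈ G.edgeSet) ∧
    ∀ e ∈ M, ∀ f ∈ M, e ≠ f → ∀ v : V, ¬ (v ∈ e ∧ v ∈ f)

/-- `m_k(G)`: the number of matchings of `G` that consist of exactly `k` edges. -/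
noncomputable def matchingCount {V : Type*} (G : SimpleGraph V) (k : ℕ) : ℕ :=
  Set.ncard {M : Finset (Sym2 V) | IsEdgeMatching G M ∧ M.card = k}

/-- The matching polynomial `μ_G(x) = ∑_{k ≥ 0} (-1)^k m_k(G) x^(n-2k)` of a graph on `n` vertices.
A matching with `k` edges covers `2k` vertices, so only the terms with `k ≤ n/2` occur. -/
noncomputable def matchingPolynomial {V : Type*} [Fintype V] (G : SimpleGraph V) :
    Polynomial ℝ :=
  ∑ k ∈ Finset.range (Fintype.card V / 2 + 1),
    Polynomial.C ((-1 : ℝ) ^ k * (matchingCount G k : ℝ)) *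
      Polynomial.X ^ (Fintype.card V - 2 * k)

/-- `ρ(p)`: the largest absolute value of the (complex) roots of a real polynomial `p`. -/
noncomputable def rootRadius (p : Polynomial ℝ) : ℝ :=
  sSup {r : ℝ | ∃ z : ℂ, Polynomial.aeval z p = 0 ∧ r = ‖z‖}

/-- An orientation of `G` with respect to the edges of `F`, which stay unoriented: a skew-symmetric
map with values in `{0, 1, -1}` that is nonzero exactly at the ordered pairs that form an edge of
`G` outside `F`.  The value `1` at `(u, v)` means that the edge `{u, v}` is oriented from `u`
to `v`.  (On the pairs of `F`, where an orientation is not defined, the map is set to `0`.) -/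
structure PartialOrientation {V : Type*} (G F : SimpleGraph V) where
  sign : V → V → ℤ
  sign_mem : ∀ u v, sign u v ∈ ({0, 1, -1} : Set ℤ)
  skew : ∀ u v, sign u v = - sign v u
  ne_zero_iff : ∀ u v, sign u v ≠ 0 ↔ (G.Adj u v ∧ ¬ F.Adj u v)

open scoped Classical in
/-- The Hermitian adjacency matrix of the mixed graph obtained from `G` by leaving the edges of
`F` unoriented and orienting the other edges by `σ`. -/
noncomputable def PartialOrientation.hermitianAdjMatrix {V : Type*} {G F : SimpleGraph V}
    (σ : PartialOrientation G F) : Matrix V V ℂ :=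
  Matrix.of fun u v =>
    if F.Adj u v then 1
    else if G.Adj u v then Complex.I * (σ.sign u v : ℂ)
    else 0

/-- The spectral radius of a mixed graph: the largest modulus of the eigenvalues of its Hermitian
adjacency matrix. -/
noncomputable def PartialOrientation.rho {V : Type*} [Fintype V] [DecidableEq V]
    {G F : SimpleGraph V} (σ : PartialOrientation G F) : ℝ :=
  sSup {r : ℝ | ∃ z ∈ spectrum ℂ σ.hermitianAdjMatrix, r = ‖z‖}

/-! The average of the characteristic polynomials over all partial orientations is
`matchingPolynomial G` (`sum_det_eq_matchingPolynomial`): in the permutation expansion, involutions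
along edges give the matching terms, while a cycle of length at least 3 along edges must leave the
acyclic `T`, and flipping the sign of that free edge cancels its terms.

An average alone controls no single polynomial, so an interlacing argument in the style of mixed
characteristic polynomials is used. Up to a matrix independent of the orientation, each free edge
enters `-H` as minus a rank one matrix (`baseMatrix_sub`), so averages over the signs not yet fixed
are instances of `sumDet`, up to normalization. These do not vanish where the quadratic form has
positive imaginary part (`sumDet_ne_zero`). This gives real roots, and also monotonicity along real
rays of the relative drop caused by a rank one subtraction (`antitoneOn_shiftVal_ratio`). Signs can
then be fixed one edge at a time while positivity on a whole ray survives (`exists_choice_det_pos`).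
Since `G` is bipartite, spectra are symmetric about 0, so controlling the largest eigenvalue
controls the spectral radius. -/

open Matrix Filter Topology

set_option linter.unusedSectionVars false

/-! ### Stability of averaged determinants under rank one perturbations -/

section RankOneAverages

variable {V ι : Type*} [Fintype V] [DecidableEq V] [Fintype ι] [DecidableEq ι]

/-- The rank one matrix `v vᴴ`. -/
def outerSquare (v : V → ℂ) : Matrix V V ℂ := vecMulVec v (star v)

/-- The quadratic form of `A` has positive imaginary part. -/
def HasPosIm (A : Matrix V V ℂ) : Prop := ∀ x : V → ℂ, x ≠ 0 → 0 < (star x ⬝ᵥ A *ᵥ x).im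

/-- The sum over all sign choices of the determinant of `A` minus a sum of rank one matrices. -/
noncomputable def sumDet (w : ι → Bool → V → ℂ) (S : Finset ι) (A : Matrix V V ℂ) : ℂ :=
  ∑ s : ι → Bool, (A - ∑ e ∈ S, outerSquare (w e (s e))).det

lemma outerSquare_form (v x : V → ℂ) :
    star x ⬝ᵥ outerSquare v *ᵥ x = ((‖star v ⬝ᵥ x‖ ^ 2 : ℝ) : ℂ) := by
  have h : star x ⬝ᵥ v = star (star v ⬝ᵥ x) := by
    simp [dotProduct, mul_comm]
  rw [outerSquare, vecMulVec_mulVec, dotProduct_smul, h]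
  simp only [MulOpposite.smul_eq_mul_unop, MulOpposite.unop_op, Complex.star_def]
  rw [← Complex.normSq_eq_conj_mul_self, Complex.normSq_eq_norm_sq]

lemma outerSquare_isHermitian (v : V → ℂ) : (outerSquare v).IsHermitian := by
  ext i j
  simp [outerSquare, vecMulVec_apply, mul_comm]

lemma HasPosIm.det_ne_zero {A : Matrix V V ℂ} (hA : HasPosIm A) : A.det ≠ 0 := by
  intro h
  obtain ⟨x, hx, hx'⟩ := exists_mulVec_eq_zero_iff.mpr h
  have := hA x hx
  simp [hx'] at this

lemma HasPosIm.add_smul {A : Matrix V V ℂ} (hA : HasPosIm A) (v : V → ℂ) {s : ℂ} (hs : 0 ≤ s.im) :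
    HasPosIm (A + s • outerSquare v) := by
  intro x hx
  rw [add_mulVec, dotProduct_add, smul_mulVec, dotProduct_smul, outerSquare_form, smul_eq_mul,
    Complex.add_im, Complex.im_mul_ofReal]
  have := hA x hx
  positivity

lemma HasPosIm.sub {A : Matrix V V ℂ} (hA : HasPosIm A) (v : V → ℂ) :
    HasPosIm (A - outerSquare v) := by
  simpa [sub_eq_add_neg] using hA.add_smul v (s := -1) (by simp)

lemma HasPosIm.sub_sum {A : Matrix V V ℂ} (hA : HasPosIm A) (v : ι → V → ℂ) (S : Finset ι) :
    HasPosIm (A - ∑ e ∈ S, outerSquare (v e)) := by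
  induction S using Finset.induction_on with
  | empty => simpa using hA
  | insert e S he ih =>
    rw [Finset.sum_insert he, add_comm, ← sub_sub]
    exact ih.sub _

lemma hasPosIm_add_smul_one {A : Matrix V V ℂ} (hA : A.IsHermitian) {z : ℂ} (hz : 0 < z.im) :
    HasPosIm (A + z • (1 : Matrix V V ℂ)) := by
  intro x hx
  have h1 : (star x ⬝ᵥ A *ᵥ x).im = 0 := hA.im_star_dotProduct_mulVec_self x
  have h2 : star x ⬝ᵥ x = ((∑ i, ‖x i‖ ^ 2 : ℝ) : ℂ) := by
    simp only [dotProduct, Pi.star_apply, Complex.star_def, Complex.ofReal_sum]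
    refine Finset.sum_congr rfl fun i _ => ?_
    rw [← Complex.normSq_eq_conj_mul_self, Complex.normSq_eq_norm_sq]
  rw [add_mulVec, dotProduct_add, smul_mulVec, dotProduct_smul, one_mulVec, h2, smul_eq_mul,
    Complex.add_im, Complex.im_mul_ofReal, h1, zero_add]
  refine mul_pos hz ?_
  obtain ⟨i, hi⟩ := Function.ne_iff.mp hx
  exact Finset.sum_pos' (fun _ _ => by positivity)
    ⟨i, Finset.mem_univ _, by have : 0 < ‖x i‖ := norm_pos_iff.mpr hi
                              positivity⟩

/-- By the matrix determinant lemma the determinant is affine in `s`; its slope is read off at `s =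
-1`. -/
lemma det_add_smul_outerSquare {A : Matrix V V ℂ} (hA : A.det ≠ 0) (v : V → ℂ) (s : ℂ) :
    (A + s • outerSquare v).det = A.det + s * (A.det - (A - outerSquare v).det) := by
  have key : ∀ s : ℂ, (A + s • outerSquare v).det =
      A.det + s * (A.det * (star v ⬝ᵥ A⁻¹ *ᵥ v)) := by
    intro s
    have h : s • outerSquare v = replicateCol Unit (s • v) * replicateRow Unit (star v) := by
      rw [outerSquare, ← smul_vecMulVec, vecMulVec_eq Unit]
    rw [h, det_add_replicateCol_mul_replicateRow (isUnit_iff_ne_zero.mpr hA)]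
    have : (1 + replicateRow Unit (star v) * A⁻¹ * replicateCol Unit (s • v)).det =
        1 + s * (star v ⬝ᵥ A⁻¹ *ᵥ v) := by
      rw [Matrix.mul_assoc, ← replicateCol_mulVec, mulVec_smul, det_unique]
      simp [Matrix.mul_apply, dotProduct, Finset.mul_sum]
    rw [this]; ring
  have h1 := key (-1)
  rw [neg_one_smul, ← sub_eq_add_neg] at h1
  rw [key s, h1]; ring

variable (w : ι → Bool → V → ℂ)

lemma sumDet_add_smul (S : Finset ι) {A : Matrix V V ℂ} (hA : HasPosIm A) (v : V → ℂ) (s : ℂ) :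
    sumDet w S (A + s • outerSquare v) =
      sumDet w S A + s * (sumDet w S A - sumDet w S (A - outerSquare v)) := by
  simp only [sumDet]
  rw [← Finset.sum_sub_distrib, Finset.mul_sum, ← Finset.sum_add_distrib]
  refine Finset.sum_congr rfl fun t _ => ?_
  have := det_add_smul_outerSquare (hA.sub_sum (fun e => w e (t e)) S).det_ne_zero v s
  rw [sub_right_comm, ← this, sub_add_eq_add_sub]

/-- Flipping the sign at `e` permutes the sign choices, so they can be paired. The factor 2 appears
because `sumDet` always sums over all of `ι → Bool`, including coordinates outside `S`. -/
lemma two_mul_sumDet_insert {S : Finset ι} {e : ι} (he : e ∉ S) (A : Matrix V V ℂ) :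
    2 * sumDet w (insert e S) A = sumDet w S (A - outerSquare (w e true)) +
      sumDet w S (A - outerSquare (w e false)) := by
  have hinv : Function.Involutive fun s : ι → Bool => Function.update s e (!(s e)) := by
    intro s; ext i; by_cases h : i = e
    · subst h; simp
    · simp [h]
  have h2 := Equiv.sum_comp hinv.toPerm
    fun s : ι → Bool => (A - ∑ i ∈ insert e S, outerSquare (w i (s i))).det
  have h3 : 2 * sumDet w (insert e S) A =
      ∑ s : ι → Bool, (A - ∑ i ∈ insert e S, outerSquare (w i (s i))).det +
      ∑ s : ι → Bool, (A - ∑ i ∈ insert e S,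
        outerSquare (w i (Function.update s e (!(s e)) i))).det := by
    rw [two_mul]; congr 1; exact h2.symm
  rw [h3, sumDet, sumDet, ← Finset.sum_add_distrib, ← Finset.sum_add_distrib]
  refine Finset.sum_congr rfl fun s _ => ?_
  rw [Finset.sum_insert he, Finset.sum_insert he]
  have h4 : ∑ i ∈ S, outerSquare (w i (Function.update s e (!(s e)) i)) =
      ∑ i ∈ S, outerSquare (w i (s i)) := by
    refine Finset.sum_congr rfl fun i hi => ?_
    rw [Function.update_of_ne (ne_of_mem_of_not_mem hi he)]
  rw [h4, Function.update_self, ← sub_sub, ← sub_sub]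
  cases s e
  · rw [add_comm]; rfl
  · rfl

/-- Otherwise the zero `s = -g / D` of the affine function would lie in the closed upper half-plane.
-/
lemma im_slope_nonpos {g D : ℂ} (h : ∀ s : ℂ, 0 ≤ s.im → g + s * D ≠ 0) :
    (D / g).im < 0 ∨ D = 0 := by
  have hg : g ≠ 0 := by simpa using h 0
  by_cases hD : D = 0
  · exact Or.inr hD
  · left
    by_contra! hc
    refine h (-(D / g)⁻¹) ?_ ?_
    · rw [Complex.neg_im, Complex.inv_im, neg_div, neg_neg]
      exact div_nonneg hc (Complex.normSq_nonneg _)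
    · field_simp
      ring

lemma sumDet_slope {S : Finset ι} (hS : ∀ A : Matrix V V ℂ, HasPosIm A → sumDet w S A ≠ 0)
    {A : Matrix V V ℂ} (hA : HasPosIm A) (v : V → ℂ) :
    ((sumDet w S A - sumDet w S (A - outerSquare v)) / sumDet w S A).im < 0 ∨
      sumDet w S A - sumDet w S (A - outerSquare v) = 0 := by
  refine im_slope_nonpos fun s hs => ?_
  rw [← sumDet_add_smul w S hA]
  exact hS _ (hA.add_smul v hs)

lemma sumDet_ne_zero (S : Finset ι) : ∀ A : Matrix V V ℂ, HasPosIm A → sumDet w S A ≠ 0 := by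
  induction S using Finset.induction_on with
  | empty =>
    intro A hA
    simpa [sumDet] using hA.det_ne_zero
  | insert e S he ih =>
    intro A hA h0
    have h := two_mul_sumDet_insert w he A
    have hg := ih A hA
    rw [h0, mul_zero] at h
    set g := sumDet w S A
    have h1 := sumDet_slope w ih hA (w e true)
    have h2 := sumDet_slope w ih hA (w e false)
    change ((g - _) / g).im < 0 ∨ g - _ = 0 at h1 h2
    set a := sumDet w S (A - outerSquare (w e true))
    set b := sumDet w S (A - outerSquare (w e false))
    -- If the average vanishes, the two relative drops add up to the real number 2; but each is zero
    -- or has negative imaginary part.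
    have h3 : (g - a) / g + (g - b) / g = 2 := by
      field_simp
      linear_combination h
    have h4 := congrArg Complex.im h3
    have h5 : ∀ c, g - c = 0 → ((g - c) / g).im = 0 := fun c hc => by rw [hc]; simp
    rw [Complex.add_im] at h4
    norm_num at h4
    rcases h1 with h1 | h1 <;> rcases h2 with h2 | h2
    · linarith
    · linarith [h5 _ h2]
    · linarith [h5 _ h1]
    · rw [h1, h2] at h3; norm_num at h3

lemma star_sumDet (S : Finset ι) {A : Matrix V V ℂ} (hA : A.IsHermitian) :
    star (sumDet w S A) = sumDet w S A := by
  rw [sumDet, star_sum]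
  refine Finset.sum_congr rfl fun s _ => ?_
  rw [← det_conjTranspose]
  congr 1
  refine hA.sub ?_
  rw [IsHermitian, conjTranspose_sum]
  exact Finset.sum_congr rfl fun e _ => outerSquare_isHermitian _

lemma im_sumDet (S : Finset ι) {A : Matrix V V ℂ} (hA : A.IsHermitian) :
    (sumDet w S A).im = 0 :=
  Complex.conj_eq_iff_im.mp (star_sumDet w S hA)

lemma isHermitian_add_real_smul_one {A : Matrix V V ℂ} (hA : A.IsHermitian) (t : ℝ) :
    (A + (t : ℂ) • (1 : Matrix V V ℂ)).IsHermitian := by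
  refine hA.add ?_
  rw [IsHermitian, conjTranspose_smul]
  simp

lemma differentiable_det_add_smul_one (A : Matrix V V ℂ) :
    Differentiable ℂ fun z : ℂ => (A + z • (1 : Matrix V V ℂ)).det := by
  simp only [det_apply, Matrix.add_apply, Matrix.smul_apply, Units.smul_def, zsmul_eq_mul]
  fun_prop

lemma differentiable_sumDet (S : Finset ι) (A : Matrix V V ℂ) :
    Differentiable ℂ fun z : ℂ => sumDet w S (A + z • (1 : Matrix V V ℂ)) := by
  simp only [sumDet, add_sub_right_comm]
  exact Differentiable.fun_sum fun s _ => differentiable_det_add_smul_one _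

lemma tendsto_det_div_pow (A : Matrix V V ℂ) :
    Tendsto (fun t : ℝ => (A + (t : ℂ) • (1 : Matrix V V ℂ)).det / (t : ℂ) ^ Fintype.card V)
      atTop (𝓝 1) := by
  have h : Tendsto (fun t : ℝ => (((t⁻¹ : ℝ) : ℂ) • A + 1).det) atTop (𝓝 1) := by
    have hc : Continuous fun u : ℝ => ((u : ℂ) • A + 1).det := by
      refine Continuous.matrix_det ?_
      fun_prop
    have := (hc.tendsto 0).comp tendsto_inv_atTop_zero
    simp only [Complex.ofReal_zero, zero_smul, zero_add, det_one] at this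
    exact this
  refine h.congr' ?_
  filter_upwards [eventually_gt_atTop 0] with t ht
  have ht' : (t : ℂ) ≠ 0 := by exact_mod_cast ht.ne'
  have : A + (t : ℂ) • (1 : Matrix V V ℂ) = (t : ℂ) • (((t⁻¹ : ℝ) : ℂ) • A + 1) := by
    rw [smul_add, smul_smul]
    simp [ht']
  rw [this, det_smul]
  field_simp

lemma tendsto_sumDet_div_pow (S : Finset ι) (A : Matrix V V ℂ) :
    Tendsto (fun t : ℝ => sumDet w S (A + (t : ℂ) • (1 : Matrix V V ℂ)) /
      (t : ℂ) ^ Fintype.card V) atTop (𝓝 (Fintype.card (ι → Bool))) := by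
  simp only [sumDet, add_sub_right_comm, Finset.sum_div]
  have := tendsto_finsetSum (Finset.univ : Finset (ι → Bool)) fun s _ =>
    tendsto_det_div_pow (A - ∑ e ∈ S, outerSquare (w e (s e)))
  simpa using this

end RankOneAverages

/-! ### Monotonicity along real rays and the choice of signs -/

section Monotone

/-- By Cauchy–Riemann, the real part of the derivative is the vertical derivative of the imaginary
part, which starts at 0 and cannot become positive above the real axis. -/
lemma deriv_re_nonpos_of_im_nonpos {h : ℂ → ℂ} {t : ℝ} (hd : DifferentiableAt ℂ h t)
    (h0 : (h t).im = 0) (him : ∀ z : ℂ, 0 < z.im → (h z).im ≤ 0) :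
    (deriv h t).re ≤ 0 := by
  have h1 : HasDerivAt (fun ε : ℝ => h (t + ε * Complex.I)) (deriv h t * Complex.I) 0 := by
    have hi : HasDerivAt (fun z : ℂ => (t : ℂ) + z * Complex.I) Complex.I ((0 : ℝ) : ℂ) := by
      simpa using ((hasDerivAt_id ((0 : ℝ) : ℂ)).mul_const Complex.I).const_add (t : ℂ)
    have hd' : HasDerivAt h (deriv h t) ((t : ℂ) + ((0 : ℝ) : ℂ) * Complex.I) := by
      simpa using hd.hasDerivAt
    exact (HasDerivAt.comp (h₂ := h) (h := fun z : ℂ => (t : ℂ) + z * Complex.I)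
      ((0 : ℝ) : ℂ) hd' hi).comp_ofReal
  have h2 : HasDerivAt (fun ε : ℝ => (h (t + ε * Complex.I)).im) (deriv h t).re 0 := by
    have := Complex.imCLM.hasFDerivAt.comp_hasDerivAt (0 : ℝ) h1
    simpa [Function.comp_def] using this
  have h3 := h2.tendsto_slope_zero_right
  refine le_of_tendsto h3 ?_
  filter_upwards [self_mem_nhdsWithin] with ε hε
  have hε' : (0 : ℝ) < ε := hε
  have := him (t + ε * Complex.I) (by simpa using hε')
  simp only [zero_add, Complex.ofReal_zero, zero_mul, add_zero, h0, sub_zero, smul_eq_mul]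
  exact mul_nonpos_of_nonneg_of_nonpos (by positivity) this

lemma antitoneOn_re_of_im_nonpos {h : ℂ → ℂ} {a : ℝ}
    (hd : ∀ t : ℝ, a ≤ t → DifferentiableAt ℂ h t)
    (h0 : ∀ t : ℝ, (h t).im = 0) (him : ∀ z : ℂ, 0 < z.im → (h z).im ≤ 0) :
    AntitoneOn (fun t : ℝ => (h t).re) (Set.Ici a) := by
  have hr : ∀ t : ℝ, a ≤ t → HasDerivAt (fun t : ℝ => (h t).re) (deriv h t).re t := fun t ht =>
    (hd t ht).hasDerivAt.real_of_complex
  refine antitoneOn_of_deriv_nonpos (convex_Ici a)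
    (fun t ht => (hr t ht).continuousAt.continuousWithinAt)
    (fun t ht => (hr t (interior_subset ht)).differentiableAt.differentiableWithinAt) ?_
  intro t ht
  rw [(hr t (interior_subset ht)).deriv]
  exact deriv_re_nonpos_of_im_nonpos (hd t (interior_subset ht)) (h0 t) him

variable {V ι : Type*} [Fintype V] [DecidableEq V] [Fintype ι] [DecidableEq ι]
variable (w : ι → Bool → V → ℂ)

/-- The real value of `sumDet` on a shift of a Hermitian matrix. -/
noncomputable def shiftVal (S : Finset ι) (A : Matrix V V ℂ) (t : ℝ) : ℝ :=
  (sumDet w S (A + (t : ℂ) • (1 : Matrix V V ℂ))).re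

lemma continuous_shiftVal (S : Finset ι) (A : Matrix V V ℂ) : Continuous (shiftVal w S A) :=
  Complex.continuous_re.comp
    ((differentiable_sumDet w S A).continuous.comp Complex.continuous_ofReal)

lemma ofReal_shiftVal (S : Finset ι) {A : Matrix V V ℂ} (hA : A.IsHermitian) (t : ℝ) :
    (shiftVal w S A t : ℂ) = sumDet w S (A + (t : ℂ) • (1 : Matrix V V ℂ)) := by
  apply Complex.ext
  · rfl
  · rw [Complex.ofReal_im, im_sumDet w S (isHermitian_add_real_smul_one hA t)]

lemma tendsto_shiftVal_div_pow (S : Finset ι) {A : Matrix V V ℂ} (hA : A.IsHermitian) :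
    Tendsto (fun t : ℝ => shiftVal w S A t / t ^ Fintype.card V) atTop
      (𝓝 (Fintype.card (ι → Bool))) := by
  have h := (Complex.continuous_re.tendsto _).comp (tendsto_sumDet_div_pow w S A)
  simp only [Complex.natCast_re] at h
  refine h.congr fun t => ?_
  rw [Function.comp_apply, ← ofReal_shiftVal w S hA]
  norm_cast

lemma eventually_shiftVal_pos (S : Finset ι) {A : Matrix V V ℂ} (hA : A.IsHermitian) :
    ∀ᶠ t in atTop, 0 < shiftVal w S A t := by
  have h : (0 : ℝ) < Fintype.card (ι → Bool) := by exact_mod_cast Fintype.card_pos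
  filter_upwards [(tendsto_shiftVal_div_pow w S hA).eventually (lt_mem_nhds h),
    eventually_gt_atTop 0] with t ht ht0
  have := mul_pos ht (pow_pos ht0 (Fintype.card V))
  rwa [div_mul_cancel₀ _ (pow_pos ht0 _).ne'] at this

lemma antitoneOn_shiftVal_ratio (S : Finset ι) {A : Matrix V V ℂ} (hA : A.IsHermitian)
    (v : V → ℂ) {a : ℝ} (ha : ∀ t, a ≤ t → shiftVal w S A t ≠ 0) :
    AntitoneOn (fun t => (shiftVal w S A t - shiftVal w S (A - outerSquare v) t) /
      shiftVal w S A t) (Set.Ici a) := by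
  have hA' : (A - outerSquare v).IsHermitian := hA.sub (outerSquare_isHermitian v)
  let h : ℂ → ℂ := fun z => (sumDet w S (A + z • (1 : Matrix V V ℂ)) -
    sumDet w S (A - outerSquare v + z • (1 : Matrix V V ℂ))) /
      sumDet w S (A + z • (1 : Matrix V V ℂ))
  have hh : ∀ t : ℝ, h t = (((shiftVal w S A t - shiftVal w S (A - outerSquare v) t) /
      shiftVal w S A t : ℝ) : ℂ) := by
    intro t
    push_cast
    rw [ofReal_shiftVal w S hA, ofReal_shiftVal w S hA']
  have key := antitoneOn_re_of_im_nonpos (h := h) (a := a) ?_ ?_ ?_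
  · simpa only [hh, Complex.ofReal_re] using key
  · intro t ht
    refine DifferentiableAt.div ?_ (differentiable_sumDet w S A _) ?_
    · exact (differentiable_sumDet w S A _).sub (differentiable_sumDet w S _ _)
    · rw [← ofReal_shiftVal w S hA]
      exact_mod_cast ha t ht
  · intro t
    rw [hh, Complex.ofReal_im]
  · intro z hz
    have := sumDet_slope w (sumDet_ne_zero w S) (hasPosIm_add_smul_one hA hz) v
    change ((_ - sumDet w S (A - outerSquare v + z • (1 : Matrix V V ℂ))) / _).im ≤ 0
    rw [sub_add_eq_add_sub]
    rcases this with h1 | h1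
    · exact h1.le
    · rw [h1]; simp

lemma tendsto_shiftVal_ratio (S : Finset ι) {A : Matrix V V ℂ} (hA : A.IsHermitian) (v : V → ℂ) :
    Tendsto (fun t => (shiftVal w S A t - shiftVal w S (A - outerSquare v) t) /
      shiftVal w S A t) atTop (𝓝 0) := by
  have hA' : (A - outerSquare v).IsHermitian := hA.sub (outerSquare_isHermitian v)
  have h1 := tendsto_shiftVal_div_pow w S hA
  have h2 := tendsto_shiftVal_div_pow w S hA'
  have hc : (Fintype.card (ι → Bool) : ℝ) ≠ 0 := by exact_mod_cast Fintype.card_ne_zero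
  have h3 := (h1.sub h2).div h1 hc
  rw [sub_self, zero_div] at h3
  refine h3.congr' ?_
  filter_upwards [eventually_gt_atTop 0] with t ht
  have := (pow_pos ht (Fintype.card V)).ne'
  simp only [Pi.div_apply]
  rw [← sub_div, div_div_div_cancel_right₀ this]

/-- The relative drop is antitone and tends to 0 at infinity, hence is nonnegative. -/
lemma shiftVal_sub_le (S : Finset ι) {A : Matrix V V ℂ} (hA : A.IsHermitian) (v : V → ℂ) {a : ℝ}
    (ha : ∀ t, a ≤ t → 0 < shiftVal w S A t) :
    shiftVal w S (A - outerSquare v) a ≤ shiftVal w S A a := by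
  have hmono := antitoneOn_shiftVal_ratio w S hA v (a := a) fun t ht => (ha t ht).ne'
  have h0 := le_of_tendsto (tendsto_shiftVal_ratio w S hA v)
    (by filter_upwards [eventually_ge_atTop a] with t ht using hmono Set.self_mem_Ici ht ht)
  have := mul_nonneg h0 (ha a le_rfl).le
  rw [div_mul_cancel₀ _ (ha a le_rfl).ne'] at this
  linarith

/-- At the last point `t₀` where positivity fails, `shiftVal_sub_le` to the right and continuity
bound both signed values by a nonpositive number, contradicting the positivity of their sum. -/
lemma shiftVal_pos_of_insert {S : Finset ι} {e : ι} (he : e ∉ S) {A : Matrix V V ℂ}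
    (hA : A.IsHermitian) (h : ∀ t, 0 ≤ t → 0 < shiftVal w (insert e S) A t) :
    ∀ t, 0 ≤ t → 0 < shiftVal w S A t := by
  have hsum : ∀ t, 2 * shiftVal w (insert e S) A t =
      shiftVal w S (A - outerSquare (w e true)) t +
      shiftVal w S (A - outerSquare (w e false)) t := by
    intro t
    have := congrArg Complex.re (two_mul_sumDet_insert w he (A + (t : ℂ) • (1 : Matrix V V ℂ)))
    rw [add_sub_right_comm, add_sub_right_comm] at this
    simpa [shiftVal] using this
  by_contra! hc
  obtain ⟨t₁, ht₁, hg₁⟩ := hc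
  obtain ⟨b, hb⟩ := eventually_atTop.mp (eventually_shiftVal_pos w S hA)
  let Z : Set ℝ := {t | 0 ≤ t ∧ shiftVal w S A t ≤ 0}
  have hZc : IsClosed Z :=
    (isClosed_le continuous_const continuous_id).inter
      (isClosed_le (continuous_shiftVal w S A) continuous_const)
  have hZb : BddAbove Z := ⟨b, fun t ht => by
    by_contra! hlt
    exact absurd (hb t hlt.le) (not_lt.mpr ht.2)⟩
  have hZ := hZc.csSup_mem ⟨t₁, ht₁, hg₁⟩ hZb
  set t₀ := sSup Z
  have hpos : ∀ t, t₀ < t → 0 < shiftVal w S A t := by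
    intro t ht
    by_contra! hle
    exact absurd (le_csSup hZb (show t ∈ Z from ⟨hZ.1.trans ht.le, hle⟩)) (not_le.mpr ht)
  have hle : ∀ v : V → ℂ, shiftVal w S (A - outerSquare v) t₀ ≤ shiftVal w S A t₀ := by
    intro v
    refine ContinuousWithinAt.closure_le (s := Set.Ioi t₀) (by simp)
      (continuous_shiftVal w S _).continuousWithinAt
      (continuous_shiftVal w S _).continuousWithinAt ?_
    intro t ht
    exact shiftVal_sub_le w S hA v fun u hu => hpos u (lt_of_lt_of_le ht hu)
  have := h t₀ hZ.1
  linarith [hsum t₀, hle (w e true), hle (w e false), hZ.2]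

/-- At 0 one of the two signed values is positive. Its quotient by the positive `shiftVal w S A` is
one minus an antitone function, so it stays positive to the right: the decision at 0 suffices for
the whole ray. -/
lemma exists_shiftVal_pos_of_insert {S : Finset ι} {e : ι} (he : e ∉ S) {A : Matrix V V ℂ}
    (hA : A.IsHermitian) (h : ∀ t, 0 ≤ t → 0 < shiftVal w (insert e S) A t) :
    ∃ b, ∀ t, 0 ≤ t → 0 < shiftVal w S (A - outerSquare (w e b)) t := by
  have hg := shiftVal_pos_of_insert w he hA h
  have key : ∀ b, 0 < shiftVal w S (A - outerSquare (w e b)) 0 →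
      ∀ t, 0 ≤ t → 0 < shiftVal w S (A - outerSquare (w e b)) t := by
    intro b hb t ht
    have h1 := antitoneOn_shiftVal_ratio w S hA (w e b) (a := 0) (fun t ht => (hg t ht).ne')
      Set.self_mem_Ici ht ht
    simp only [sub_div, div_self (hg t ht).ne', div_self (hg 0 le_rfl).ne'] at h1
    have h2 := div_pos hb (hg 0 le_rfl)
    have h3 : 0 < shiftVal w S (A - outerSquare (w e b)) t / shiftVal w S A t := by linarith
    have := mul_pos h3 (hg t ht)
    rwa [div_mul_cancel₀ _ (hg t ht).ne'] at this
  have hsum : 2 * shiftVal w (insert e S) A 0 =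
      shiftVal w S (A - outerSquare (w e true)) 0 +
      shiftVal w S (A - outerSquare (w e false)) 0 := by
    have := congrArg Complex.re
      (two_mul_sumDet_insert w he (A + ((0 : ℝ) : ℂ) • (1 : Matrix V V ℂ)))
    rw [add_sub_right_comm, add_sub_right_comm] at this
    simpa [shiftVal] using this
  have h0 := h 0 le_rfl
  by_cases hb : 0 < shiftVal w S (A - outerSquare (w e true)) 0
  · exact ⟨true, key true hb⟩
  · exact ⟨false, key false (by linarith)⟩

/-- If the sum of the determinants is positive along a ray, then some choice of signs gives a
determinant that is positive along the same ray. -/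
theorem exists_choice_det_pos (S : Finset ι) : ∀ A : Matrix V V ℂ, A.IsHermitian →
    (∀ t, 0 ≤ t → 0 < shiftVal w S A t) →
    ∃ s : ι → Bool, ∀ t : ℝ, 0 ≤ t →
      0 < (A - ∑ e ∈ S, outerSquare (w e (s e)) + (t : ℂ) • (1 : Matrix V V ℂ)).det.re := by
  induction S using Finset.induction_on with
  | empty =>
    intro A _ h
    refine ⟨fun _ => true, fun t ht => ?_⟩
    have := h t ht
    simp only [shiftVal, sumDet, Finset.sum_empty, sub_zero, Finset.sum_const, nsmul_eq_mul,
      Complex.mul_re, Complex.natCast_re, Complex.natCast_im, zero_mul] at this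
    rw [Finset.sum_empty, sub_zero]
    exact pos_of_mul_pos_right this (Nat.cast_nonneg _)
  | insert e S he ih =>
    intro A hA h
    obtain ⟨b, hb⟩ := exists_shiftVal_pos_of_insert w he hA h
    obtain ⟨s, hs⟩ := ih _ (hA.sub (outerSquare_isHermitian _)) hb
    refine ⟨Function.update s e b, fun t ht => ?_⟩
    have h4 : ∑ i ∈ S, outerSquare (w i (Function.update s e b i)) =
        ∑ i ∈ S, outerSquare (w i (s i)) := by
      refine Finset.sum_congr rfl fun i hi => ?_
      rw [Function.update_of_ne (ne_of_mem_of_not_mem hi he)]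
    rw [Finset.sum_insert he, h4, Function.update_self, ← sub_sub]
    exact hs t ht

end Monotone

/-! ### Matchings as involutions -/

section Matchings

open scoped Classical in
/-- The involutions that move vertices only along edges of `G`. -/
noncomputable def edgeInvolutions {V : Type*} [Fintype V] (G : SimpleGraph V) :
    Finset (Equiv.Perm V) :=
  {π | (∀ i, π (π i) = i) ∧ ∀ i, π i ≠ i → G.Adj i (π i)}

variable {V : Type*} [Fintype V] [DecidableEq V] {G : SimpleGraph V}

lemma mem_edgeInvolutions {π : Equiv.Perm V} : π ∈ edgeInvolutions G ↔
    (∀ i, π (π i) = i) ∧ ∀ i, π i ≠ i → G.Adj i (π i) := by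
  simp [edgeInvolutions]

/-- The edges along which an involution moves vertices. -/
def movedEdges (π : Equiv.Perm V) : Finset (Sym2 V) := π.support.image fun i => s(i, π i)

lemma mem_movedEdges {π : Equiv.Perm V} (hπ : ∀ i, π (π i) = i) {a b : V} :
    s(a, b) ∈ movedEdges π ↔ π a = b ∧ a ≠ b := by
  simp only [movedEdges, Finset.mem_image, Equiv.Perm.mem_support, Sym2.eq_iff]
  constructor
  · rintro ⟨i, hi, ⟨rfl, rfl⟩ | ⟨rfl, rfl⟩⟩
    · exact ⟨rfl, hi.symm⟩
    · exact ⟨hπ _, hi⟩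
  · rintro ⟨rfl, h⟩
    exact ⟨a, h.symm, Or.inl ⟨rfl, rfl⟩⟩

/-- The map `i ↦ s(i, π i)` is two-to-one on the support. -/
lemma two_mul_card_movedEdges {π : Equiv.Perm V} (hπ : ∀ i, π (π i) = i) :
    2 * (movedEdges π).card = π.support.card := by
  rw [Finset.card_eq_sum_card_image (fun i => s(i, π i)) π.support, mul_comm, ← smul_eq_mul]
  symm
  refine Finset.sum_const_nat ?_
  intro e he
  obtain ⟨i, hi, rfl⟩ := Finset.mem_image.mp he
  have hi' := Equiv.Perm.mem_support.mp hi
  have : {j ∈ π.support | s(j, π j) = s(i, π i)} = {i, π i} := by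
    ext j
    simp only [Finset.mem_filter, Equiv.Perm.mem_support, Sym2.eq_iff, Finset.mem_insert,
      Finset.mem_singleton]
    constructor
    · rintro ⟨_, ⟨h, _⟩ | ⟨h, _⟩⟩
      · exact Or.inl h
      · exact Or.inr h
    · rintro (rfl | rfl)
      · exact ⟨hi', Or.inl ⟨rfl, rfl⟩⟩
      · exact ⟨by rw [hπ]; exact hi'.symm, Or.inr ⟨rfl, hπ i⟩⟩
  rw [this, Finset.card_pair hi'.symm]

lemma movedEdges_isEdgeMatching {π : Equiv.Perm V} (hπ : π ∈ edgeInvolutions G) :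
    IsEdgeMatching G (movedEdges π) := by
  obtain ⟨h1, h2⟩ := mem_edgeInvolutions.mp hπ
  constructor
  · intro e he
    induction e with
    | _ a b =>
      obtain ⟨rfl, h⟩ := (mem_movedEdges h1).mp he
      exact h2 a h.symm
  · rintro e he f hf hne v ⟨hve, hvf⟩
    obtain ⟨a, rfl⟩ := Sym2.mem_iff_exists.mp hve
    obtain ⟨b, rfl⟩ := Sym2.mem_iff_exists.mp hvf
    obtain ⟨rfl, _⟩ := (mem_movedEdges h1).mp he
    obtain ⟨rfl, _⟩ := (mem_movedEdges h1).mp hf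
    exact hne rfl

lemma movedEdges_injOn : Set.InjOn (movedEdges (V := V)) (edgeInvolutions G) := by
  intro π hπ τ hτ h
  have h1 := (mem_edgeInvolutions.mp (Finset.mem_coe.mp hπ)).1
  have h2 := (mem_edgeInvolutions.mp (Finset.mem_coe.mp hτ)).1
  ext i
  by_cases hi : π i = i
  · by_contra hne
    rw [hi] at hne
    have := (mem_movedEdges h2).mpr ⟨rfl, hne⟩
    rw [← h, mem_movedEdges h1] at this
    exact hne (hi.symm.trans this.1)
  · have := (mem_movedEdges h1).mpr ⟨rfl, Ne.symm hi⟩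
    rw [h, mem_movedEdges h2] at this
    exact this.1.symm

lemma exists_movedEdges_eq {M : Finset (Sym2 V)} (hM : IsEdgeMatching G M) :
    ∃ π ∈ edgeInvolutions G, movedEdges π = M := by
  classical
  let p : V → V := fun i => if h : ∃ j, s(i, j) ∈ M then h.choose else i
  have huniq : ∀ i j k, s(i, j) ∈ M → s(i, k) ∈ M → j = k := by
    intro i j k hj hk
    by_contra hne
    exact hM.2 _ hj _ hk (fun h => hne (Sym2.congr_right.mp h)) i
      ⟨Sym2.mem_mk_left _ _, Sym2.mem_mk_left _ _⟩
  have hp : ∀ i j, s(i, j) ∈ M → p i = j := by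
    intro i j hj
    have h : ∃ j, s(i, j) ∈ M := ⟨j, hj⟩
    have : p i = h.choose := dif_pos h
    rw [this]
    exact huniq i _ _ h.choose_spec hj
  have hp' : ∀ i, p i ≠ i → s(i, p i) ∈ M := by
    intro i hi
    by_cases h : ∃ j, s(i, j) ∈ M
    · obtain ⟨j, hj⟩ := h
      rwa [hp i j hj]
    · exact absurd (dif_neg h) hi
  have hinv : Function.Involutive p := by
    intro i
    by_cases hi : p i = i
    · rw [hi, hi]
    · exact hp _ _ (Sym2.eq_swap ▸ hp' i hi)
  have hmem : hinv.toPerm ∈ edgeInvolutions G := by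
    rw [mem_edgeInvolutions]
    exact ⟨hinv, fun i hi => hM.1 _ (hp' i hi)⟩
  refine ⟨_, hmem, ?_⟩
  ext e
  induction e with
  | _ a b =>
    rw [mem_movedEdges (mem_edgeInvolutions.mp hmem).1]
    change p a = b ∧ a ≠ b ↔ _
    constructor
    · rintro ⟨rfl, h⟩
      exact hp' a h.symm
    · intro h
      exact ⟨hp a b h, (hM.1 _ h : G.Adj a b).ne⟩

lemma matchingCount_eq_card (k : ℕ) : matchingCount G k =
    {π ∈ edgeInvolutions G | π.support.card / 2 = k}.card := by
  rw [← Set.ncard_coe_finset, matchingCount]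
  symm
  refine Set.ncard_congr (fun π _ => movedEdges π) ?_ ?_ ?_
  · intro π hπ
    rw [Finset.mem_coe, Finset.mem_filter] at hπ
    refine ⟨movedEdges_isEdgeMatching hπ.1, ?_⟩
    have := two_mul_card_movedEdges (mem_edgeInvolutions.mp hπ.1).1
    omega
  · intro π τ hπ hτ h
    rw [Finset.mem_coe, Finset.mem_filter] at hπ hτ
    exact movedEdges_injOn (G := G) hπ.1 hτ.1 h
  · rintro M ⟨hM, hk⟩
    obtain ⟨π, hπ, rfl⟩ := exists_movedEdges_eq hM
    refine ⟨π, ?_, rfl⟩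
    rw [Finset.mem_coe, Finset.mem_filter]
    have := two_mul_card_movedEdges (mem_edgeInvolutions.mp hπ).1
    exact ⟨hπ, by omega⟩

lemma aeval_matchingPolynomial (z : ℂ) : Polynomial.aeval z (matchingPolynomial G) =
    ∑ π ∈ edgeInvolutions G,
      (-1) ^ (π.support.card / 2) * z ^ (Fintype.card V - π.support.card) := by
  have hmaps : ∀ π ∈ edgeInvolutions G,
      π.support.card / 2 ∈ Finset.range (Fintype.card V / 2 + 1) := by
    intro π _
    rw [Finset.mem_range]
    have := Finset.card_le_univ π.support
    omega
  rw [← Finset.sum_fiberwise_of_maps_to hmaps, matchingPolynomial, map_sum]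
  refine Finset.sum_congr rfl fun k _ => ?_
  rw [matchingCount_eq_card]
  have : ∀ π ∈ {π ∈ edgeInvolutions G | π.support.card / 2 = k},
      (-1 : ℂ) ^ (π.support.card / 2) * z ^ (Fintype.card V - π.support.card) =
        (-1) ^ k * z ^ (Fintype.card V - 2 * k) := by
    intro π hπ
    rw [Finset.mem_filter] at hπ
    have h2 := two_mul_card_movedEdges (mem_edgeInvolutions.mp hπ.1).1
    have : π.support.card = 2 * k := by omega
    rw [hπ.2, this]
  rw [Finset.sum_congr rfl this, Finset.sum_const, nsmul_eq_mul]
  simp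
  ring

end Matchings

/-! ### Averaging characteristic polynomials over orientations -/

section Orientations

/-- An orbit of length at least 3 would be a cycle in `T`: following it from `π i` back to `i`
avoids the edge `s(i, π i)`, which is a bridge. -/
lemma SimpleGraph.IsAcyclic.perm_involutive {V : Type*} [Finite V] {T : SimpleGraph V}
    (hT : T.IsAcyclic) {π : Equiv.Perm V} (h : ∀ j, π (π j) ≠ j → T.Adj j (π j)) (i : V) :
    π (π i) = i := by
  by_contra hi
  have hbad : ∀ j, π (π j) ≠ j → π (π (π j)) ≠ π j := fun j hj h => hj (π.injective h)
  have hbridge := SimpleGraph.isAcyclic_iff_forall_adj_isBridge.mp hT (h i hi)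
  rw [SimpleGraph.isBridge_iff] at hbridge
  refine hbridge ?_
  -- The second alternative records that the orbit has already reached `i`, after which it may cross
  -- the deleted edge.
  have key : ∀ k : ℕ, π (π ((π ^ k) (π i))) ≠ (π ^ k) (π i) ∧
      ((T.deleteEdges {s(i, π i)}).Reachable (π i) ((π ^ k) (π i)) ∨
        (T.deleteEdges {s(i, π i)}).Reachable (π i) i) := by
    intro k
    induction k with
    | zero => exact ⟨hbad i hi, Or.inl (by simp)⟩
    | succ k ih =>
      rw [pow_succ', Equiv.Perm.mul_apply]
      set j := (π ^ k) (π i)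
      refine ⟨hbad j ih.1, ?_⟩
      rcases ih.2 with hr | hr
      · by_cases hj : j = i
        · exact Or.inr (hj ▸ hr)
        · refine Or.inl (hr.trans (SimpleGraph.Adj.reachable ?_))
          rw [SimpleGraph.deleteEdges_adj]
          refine ⟨h j ih.1, fun hmem => ?_⟩
          rw [Set.mem_singleton_iff, Sym2.eq_iff] at hmem
          rcases hmem with ⟨h1, _⟩ | ⟨h1, h2⟩
          · exact hj h1
          · rw [h1] at h2
            exact hi h2
      · exact Or.inr hr
  have hord : (π ^ (orderOf π - 1)) (π i) = i := by
    rw [← Equiv.Perm.mul_apply, ← pow_succ, Nat.sub_add_cancel (orderOf_pos π), pow_orderOf_eq_one]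
    rfl
  rcases (key (orderOf π - 1)).2 with hr | hr
  · rw [hord] at hr
    exact hr.symm
  · exact hr.symm

open scoped Classical in
/-- The sign of the ordered pair `(u, v)` relative to the chosen representative of `s(u, v)`. -/
noncomputable def refSign {V : Type*} (u v : V) : ℤ := if Quot.out s(u, v) = (u, v) then 1 else -1

lemma refSign_swap {V : Type*} {u v : V} (h : u ≠ v) : refSign u v = -refSign v u := by
  have h1 : s((Quot.out s(u, v)).1, (Quot.out s(u, v)).2) = s(u, v) := Quot.out_eq s(u, v)
  unfold refSign
  rw [show s(v, u) = s(u, v) from Sym2.eq_swap]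
  rcases Sym2.eq_iff.mp h1 with ⟨h2, h3⟩ | ⟨h2, h3⟩
  · have : Quot.out s(u, v) = (u, v) := Prod.ext h2 h3
    rw [this]; simp [h]
  · have : Quot.out s(u, v) = (v, u) := Prod.ext h2 h3
    rw [this]; simp [h.symm]

lemma refSign_eq_or {V : Type*} (u v : V) : refSign u v = 1 ∨ refSign u v = -1 := by
  unfold refSign; split_ifs <;> simp

/-- The sign attached to a Boolean. -/
def boolSign (b : Bool) : ℤ := if b then 1 else -1

lemma boolSign_eq_or (b : Bool) : boolSign b = 1 ∨ boolSign b = -1 := by cases b <;> simp [boolSign]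

open scoped Classical in
/-- The partial orientation given by a Boolean on each edge. -/
noncomputable def orient {V : Type*} (G T : SimpleGraph V) (s : Sym2 V → Bool) :
    PartialOrientation G T where
  sign u v := if G.Adj u v ∧ ¬ T.Adj u v then boolSign (s s(u, v)) * refSign u v else 0
  sign_mem u v := by
    split_ifs
    · rcases boolSign_eq_or (s s(u, v)) with h | h <;> rcases refSign_eq_or u v with h' | h' <;>
        simp [h, h']
    · simp
  skew u v := by
    rw [G.adj_comm, T.adj_comm, show s(v, u) = s(u, v) from Sym2.eq_swap]
    split_ifs with h
    · rw [refSign_swap h.1.ne.symm]; ring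
    · simp
  ne_zero_iff u v := by
    split_ifs with h
    · refine iff_of_true ?_ h
      rcases boolSign_eq_or (s s(u, v)) with h | h <;> rcases refSign_eq_or u v with h' | h' <;>
        simp [h, h']
    · simp [h]

variable {V : Type*} {G T : SimpleGraph V}

lemma hermitianAdjMatrix_of_not_adj (hTG : T ≤ G) (σ : PartialOrientation G T) {u v : V}
    (h : ¬ G.Adj u v) : σ.hermitianAdjMatrix u v = 0 := by
  have : ¬ T.Adj u v := fun h' => h (hTG h')
  simp [PartialOrientation.hermitianAdjMatrix, h, this]

lemma hermitianAdjMatrix_isHermitian (σ : PartialOrientation G T) :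
    σ.hermitianAdjMatrix.IsHermitian := by
  ext u v
  have hT := T.adj_comm u v
  have hG := G.adj_comm u v
  by_cases h1 : T.Adj v u <;> by_cases h2 : G.Adj v u <;>
    simp [PartialOrientation.hermitianAdjMatrix, hT, hG, h1, h2, σ.skew v u]

lemma hermitianAdjMatrix_mul_swap (σ : PartialOrientation G T) {u v : V} (h : G.Adj u v) :
    σ.hermitianAdjMatrix u v * σ.hermitianAdjMatrix v u = 1 := by
  by_cases hT : T.Adj u v
  · simp [PartialOrientation.hermitianAdjMatrix, hT, hT.symm]
  · have hne := (σ.ne_zero_iff u v).mpr ⟨h, hT⟩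
    have hsq : (σ.sign u v : ℂ) * σ.sign u v = 1 := by
      rcases σ.sign_mem u v with h' | h' | h'
      · exact absurd h' hne
      · rw [h']; simp
      · rw [Set.mem_singleton_iff.mp h']; simp
    simp only [PartialOrientation.hermitianAdjMatrix, of_apply, hT, T.adj_comm v u, h, h.symm,
      if_true, if_false, σ.skew v u, Int.cast_neg]
    linear_combination hsq - (σ.sign u v : ℂ) * σ.sign u v * Complex.I_mul_I

variable [Fintype V] [DecidableEq V]

/-- A transposition along an edge contributes `h_uv * h_vu = 1`, a fixed point contributes `z`, and
a vertex moved along a non-edge makes the product zero. -/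
lemma prod_involution_entries (hTG : T ≤ G) (σ : PartialOrientation G T) (z : ℂ)
    {π : Equiv.Perm V} (hπ : ∀ i, π (π i) = i) :
    ∏ i, (z • (1 : Matrix V V ℂ) - σ.hermitianAdjMatrix) (π i) i =
      if π ∈ edgeInvolutions G then z ^ (Fintype.card V - π.support.card) else 0 := by
  split_ifs with h
  · have h2 := (mem_edgeInvolutions.mp h).2
    rw [← Finset.prod_mul_prod_compl π.support]
    have hs : ∏ i ∈ π.support, (z • (1 : Matrix V V ℂ) - σ.hermitianAdjMatrix) (π i) i = 1 := by
      refine Finset.prod_involution (fun i _ => π i) ?_ ?_ ?_ ?_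
      · intro i hi
        have hi' := Equiv.Perm.mem_support.mp hi
        have := hermitianAdjMatrix_mul_swap σ (h2 i hi')
        simp only [Matrix.sub_apply, Matrix.smul_apply, hπ, one_apply_ne hi', one_apply_ne hi'.symm,
          smul_zero, zero_sub]
        linear_combination this
      · intro i hi _
        exact Equiv.Perm.mem_support.mp hi
      · intro i hi
        exact Equiv.Perm.apply_mem_support.mpr hi
      · intro i _
        exact hπ i
    rw [hs, one_mul, ← Finset.card_compl, ← Finset.prod_const]
    refine Finset.prod_congr rfl fun i hi => ?_
    rw [Finset.mem_compl, Equiv.Perm.notMem_support] at hi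
    rw [hi, Matrix.sub_apply, Matrix.smul_apply, one_apply_eq,
      hermitianAdjMatrix_of_not_adj hTG σ (SimpleGraph.irrefl G)]
    simp
  · have : ∃ i, π i ≠ i ∧ ¬ G.Adj i (π i) := by
      by_contra! hc
      exact h (mem_edgeInvolutions.mpr ⟨hπ, hc⟩)
    obtain ⟨i, hi, hadj⟩ := this
    refine Finset.prod_eq_zero (Finset.mem_univ i) ?_
    rw [Matrix.sub_apply, Matrix.smul_apply, one_apply_ne hi,
      hermitianAdjMatrix_of_not_adj hTG σ fun h => hadj h.symm]
    simp

lemma orient_entry_congr {s s' : Sym2 V → Bool} {u v : V} (h : s s(u, v) = s' s(u, v)) :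
    (orient G T s).hermitianAdjMatrix u v = (orient G T s').hermitianAdjMatrix u v := by
  simp [PartialOrientation.hermitianAdjMatrix, orient, h]

lemma orient_entry_not {s s' : Sym2 V → Bool} {u v : V} (hT : ¬ T.Adj u v)
    (h : s' s(u, v) = !(s s(u, v))) :
    (orient G T s').hermitianAdjMatrix u v = -(orient G T s).hermitianAdjMatrix u v := by
  have : ∀ b : Bool, boolSign (!b) = -boolSign b := by intro b; cases b <;> rfl
  by_cases hG : G.Adj u v
  · simp [PartialOrientation.hermitianAdjMatrix, orient, h, this, hG, hT]
  · simp [PartialOrientation.hermitianAdjMatrix, hG, hT]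

/-- Some step from `j` to `π j` avoids `T` and is not reversed by `π`, so the pair `s(π j, j)`
occurs in just one factor. Flipping its sign negates the product, and the sum equals its own
negative. -/
lemma sum_prod_entries_eq_zero (hT : T.IsAcyclic) (z : ℂ)
    {π : Equiv.Perm V} (hπ : ¬ ∀ i, π (π i) = i) :
    ∑ s : Sym2 V → Bool,
      ∏ i, (z • (1 : Matrix V V ℂ) - (orient G T s).hermitianAdjMatrix) (π i) i = 0 := by
  have hfix : ∀ j, π (π j) ≠ j → π j ≠ j := fun j hj h => hj (by rw [h, h])
  have : ∃ j, π (π j) ≠ j ∧ ¬ T.Adj j (π j) := by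
    by_contra! hc
    exact hπ (hT.perm_involutive hc)
  obtain ⟨j, hj, hjT⟩ := this
  have hinv : Function.Involutive
      fun s : Sym2 V → Bool => Function.update s s(π j, j) (!(s s(π j, j))) := by
    intro s; ext i; by_cases h : i = s(π j, j)
    · subst h; simp
    · simp [h]
  have hflip := Equiv.sum_comp (hinv.toPerm _) fun s : Sym2 V → Bool =>
    ∏ i, (z • (1 : Matrix V V ℂ) - (orient G T s).hermitianAdjMatrix) (π i) i
  have hneg : ∀ s : Sym2 V → Bool,
      ∏ i, (z • (1 : Matrix V V ℂ) - (orient G T (hinv.toPerm _ s)).hermitianAdjMatrix) (π i) i =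
      -∏ i, (z • (1 : Matrix V V ℂ) - (orient G T s).hermitianAdjMatrix) (π i) i := by
    intro s
    rw [← Finset.mul_prod_erase _ _ (Finset.mem_univ j),
      ← Finset.mul_prod_erase Finset.univ (fun i =>
        (z • (1 : Matrix V V ℂ) - (orient G T s).hermitianAdjMatrix) (π i) i) (Finset.mem_univ j),
      ← neg_mul]
    congr 1
    · rw [Matrix.sub_apply, Matrix.sub_apply, Matrix.smul_apply, one_apply_ne (hfix j hj),
        orient_entry_not (s := s) (fun h => hjT h.symm)
          (by change Function.update s s(π j, j) (!(s s(π j, j))) _ = _; simp)]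
      simp
    · refine Finset.prod_congr rfl fun i hi => ?_
      rw [Matrix.sub_apply, Matrix.sub_apply]
      congr 1
      refine orient_entry_congr ?_
      change Function.update s s(π j, j) (!(s s(π j, j))) _ = _
      refine Function.update_of_ne (fun h => ?_) _ _
      have hij := Finset.ne_of_mem_erase hi
      rcases Sym2.eq_iff.mp h with ⟨h1, _⟩ | ⟨h1, h2⟩
      · exact hij (π.injective h1)
      · rw [h2] at h1
        exact hj h1
  rw [Finset.sum_congr rfl fun s _ => hneg s, Finset.sum_neg_distrib] at hflip
  exact self_eq_neg.mp hflip.symm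

/-- The average characteristic polynomial over all partial orientations is the matching
polynomial. -/
theorem sum_det_eq_matchingPolynomial (hTG : T ≤ G) (hT : T.IsAcyclic) (z : ℂ) :
    ∑ s : Sym2 V → Bool, (z • (1 : Matrix V V ℂ) - (orient G T s).hermitianAdjMatrix).det =
      Fintype.card (Sym2 V → Bool) * Polynomial.aeval z (matchingPolynomial G) := by
  simp only [det_apply]
  rw [Finset.sum_comm, aeval_matchingPolynomial, Finset.mul_sum,
    ← Finset.sum_subset (Finset.subset_univ (edgeInvolutions G))]
  · refine Finset.sum_congr rfl fun π hπ => ?_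
    have h1 := (mem_edgeInvolutions.mp hπ).1
    simp only [prod_involution_entries hTG _ z h1, hπ, if_true]
    -- The sign of an involution is `(-1)` to the number of its transpositions, which is the sign of
    -- the matching term.
    have hsq : π ^ 2 = 1 := by
      ext i; simp [sq, h1]
    rw [Finset.sum_const, Finset.card_univ, nsmul_eq_mul, Equiv.Perm.sign_of_pow_two_eq_one hsq,
      Equiv.Perm.card_fixedPoints, Equiv.Perm.sum_cycleType,
      Nat.sub_sub_self (Finset.card_le_univ _), Units.smul_def, zsmul_eq_mul]
    simp
  · intro π _ hπ
    rw [← Finset.smul_sum]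
    by_cases h : ∀ i, π (π i) = i
    · simp only [prod_involution_entries hTG _ z h, hπ, if_false, Finset.sum_const_zero, smul_zero]
    · rw [sum_prod_entries_eq_zero hT z h, smul_zero]

end Orientations

/-! ### Rank one decomposition of the Hermitian adjacency matrix -/

section Decomposition

variable {V : Type*} {G T : SimpleGraph V}

open scoped Classical in
/-- The vector whose outer square contributes the oriented edge `e` to the Hermitian adjacency
matrix. -/
noncomputable def edgeVector (e : Sym2 V) (b : Bool) (x : V) : ℂ :=
  if x = (Quot.out e).1 then 1 else if x = (Quot.out e).2 then -(Complex.I * boolSign b) else 0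

lemma boolSign_mul_self (b : Bool) : (boolSign b : ℂ) * boolSign b = 1 := by
  cases b <;> simp [boolSign]

lemma outerSquare_edgeVector_self (e : Sym2 V) (b b' : Bool) (x : V) :
    outerSquare (edgeVector e b) x x = outerSquare (edgeVector e b') x x := by
  simp only [outerSquare, vecMulVec_apply, Pi.star_apply, edgeVector]
  split_ifs
  · rfl
  · simp only [star_neg, star_mul', Complex.star_def, Complex.conj_I, map_intCast]
    linear_combination (Complex.I ^ 2 * -1) * (boolSign_mul_self b - boolSign_mul_self b')
  · rfl

open scoped Classical in
lemma outerSquare_edgeVector_ne {e : Sym2 V} (b : Bool) {x y : V} (hxy : x ≠ y) :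
    outerSquare (edgeVector e b) x y =
      if e = s(x, y) then Complex.I * (boolSign b * refSign x y : ℤ) else 0 := by
  have h0 : s((Quot.out e).1, (Quot.out e).2) = e := Quot.out_eq e
  simp only [outerSquare, vecMulVec_apply, Pi.star_apply]
  split_ifs with he
  · subst he
    rcases Sym2.eq_iff.mp h0 with ⟨h1, h2⟩ | ⟨h1, h2⟩
    · have : Quot.out s(x, y) = (x, y) := Prod.ext h1 h2
      simp [edgeVector, refSign, this, hxy.symm]
    · have : Quot.out s(x, y) = (y, x) := Prod.ext h1 h2
      simp [edgeVector, refSign, this, hxy, hxy.symm]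
  · have h1 : ¬ ((Quot.out e).1 = x ∧ (Quot.out e).2 = y) := fun h =>
      he (by rw [← h0, h.1, h.2])
    have h2 : ¬ ((Quot.out e).1 = y ∧ (Quot.out e).2 = x) := fun h =>
      he (by rw [← h0, h.1, h.2, Sym2.eq_swap])
    simp only [edgeVector]
    split_ifs <;> simp_all

variable [Fintype V]

open scoped Classical in
/-- The edges of `G` outside `T`. -/
noncomputable def freeEdges (G T : SimpleGraph V) : Finset (Sym2 V) :=
  {e | e ∈ G.edgeSet ∧ e ∉ T.edgeSet}

lemma mem_freeEdges {x y : V} : s(x, y) ∈ freeEdges G T ↔ G.Adj x y ∧ ¬ T.Adj x y := by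
  simp [freeEdges]

/-- The sum of the outer squares determines the Hermitian adjacency matrix up to a constant. -/
lemma sum_outerSquare_sub (s s' : Sym2 V → Bool) :
    ∑ e ∈ freeEdges G T, outerSquare (edgeVector e (s e)) -
      (orient G T s).hermitianAdjMatrix =
    ∑ e ∈ freeEdges G T, outerSquare (edgeVector e (s' e)) -
      (orient G T s').hermitianAdjMatrix := by
  classical
  ext x y
  simp only [Matrix.sub_apply, Matrix.sum_apply]
  -- Diagonal entries are squared moduli, blind to the signs. Off the diagonal the free edges cancel
  -- against `H`, leaving only the entries of `T`.
  by_cases hxy : x = y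
  · subst hxy
    congr 1
    · exact Finset.sum_congr rfl fun e _ => outerSquare_edgeVector_self _ _ _ _
    · simp [PartialOrientation.hermitianAdjMatrix]
  · simp only [outerSquare_edgeVector_ne _ hxy, Finset.sum_ite_eq', mem_freeEdges]
    by_cases hT : T.Adj x y <;> by_cases hG : G.Adj x y <;>
      simp [PartialOrientation.hermitianAdjMatrix, orient, hT, hG]

variable [DecidableEq V]

/-- The part of the decomposition of `-H` that does not depend on the orientation. -/
noncomputable def baseMatrix (G T : SimpleGraph V) : Matrix V V ℂ :=
  ∑ e ∈ freeEdges G T, outerSquare (edgeVector e true) -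
    (orient G T fun _ => true).hermitianAdjMatrix

lemma baseMatrix_isHermitian (G T : SimpleGraph V) : (baseMatrix G T).IsHermitian := by
  refine IsHermitian.sub ?_ (hermitianAdjMatrix_isHermitian _)
  rw [IsHermitian, conjTranspose_sum]
  exact Finset.sum_congr rfl fun e _ => outerSquare_isHermitian _

lemma baseMatrix_sub (s : Sym2 V → Bool) :
    baseMatrix G T - ∑ e ∈ freeEdges G T, outerSquare (edgeVector e (s e)) =
      -(orient G T s).hermitianAdjMatrix := by
  rw [baseMatrix, sum_outerSquare_sub (fun _ => true) s]
  abel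

lemma sumDet_baseMatrix (hTG : T ≤ G) (hT : T.IsAcyclic) (z : ℂ) :
    sumDet edgeVector (freeEdges G T) (baseMatrix G T + z • (1 : Matrix V V ℂ)) =
      Fintype.card (Sym2 V → Bool) * Polynomial.aeval z (matchingPolynomial G) := by
  rw [← sum_det_eq_matchingPolynomial hTG hT, sumDet]
  refine Finset.sum_congr rfl fun s _ => ?_
  rw [add_sub_right_comm, baseMatrix_sub, neg_add_eq_sub]

end Decomposition

/-! ### Roots of the matching polynomial -/

section MatchingRoots

variable {V : Type*} [Fintype V] {G T : SimpleGraph V}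

lemma matchingCount_zero (G : SimpleGraph V) : matchingCount G 0 = 1 := by
  rw [matchingCount, Set.ncard_eq_one]
  refine ⟨∅, ?_⟩
  ext M
  simp only [Set.mem_ofPred_eq, Finset.card_eq_zero, Set.mem_singleton_iff]
  refine ⟨fun h => h.2, ?_⟩
  rintro rfl
  exact ⟨⟨by simp, by simp⟩, rfl⟩

lemma matchingPolynomial_eq_X_pow_add (G : SimpleGraph V) :
    ∃ p : Polynomial ℝ, p.degree < Fintype.card V ∧
      matchingPolynomial G = Polynomial.X ^ Fintype.card V + p := by
  refine ⟨∑ k ∈ Finset.range (Fintype.card V / 2),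
    Polynomial.C ((-1 : ℝ) ^ (k + 1) * (matchingCount G (k + 1) : ℝ)) *
      Polynomial.X ^ (Fintype.card V - 2 * (k + 1)), ?_, ?_⟩
  · refine lt_of_le_of_lt (Polynomial.degree_sum_le _ _) ?_
    rw [Finset.sup_lt_iff (WithBot.bot_lt_coe _)]
    intro k hk
    rw [Finset.mem_range] at hk
    refine lt_of_le_of_lt (Polynomial.degree_C_mul_X_pow_le _ _) ?_
    exact_mod_cast (by omega : Fintype.card V - 2 * (k + 1) < Fintype.card V)
  · rw [matchingPolynomial, Finset.sum_range_succ', add_comm]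
    simp [matchingCount_zero]

lemma matchingPolynomial_monic (G : SimpleGraph V) : (matchingPolynomial G).Monic := by
  obtain ⟨p, hp, h⟩ := matchingPolynomial_eq_X_pow_add G
  rw [h]
  exact Polynomial.monic_X_pow_add hp

lemma matchingPolynomial_degree (G : SimpleGraph V) :
    (matchingPolynomial G).degree = Fintype.card V := by
  obtain ⟨p, hp, h⟩ := matchingPolynomial_eq_X_pow_add G
  rw [h, Polynomial.degree_add_eq_left_of_degree_lt (by rwa [Polynomial.degree_X_pow]),
    Polynomial.degree_X_pow]

variable [DecidableEq V]

lemma aeval_matchingPolynomial_neg (z : ℂ) :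
    Polynomial.aeval (-z) (matchingPolynomial G) =
      (-1) ^ Fintype.card V * Polynomial.aeval z (matchingPolynomial G) := by
  rw [aeval_matchingPolynomial, aeval_matchingPolynomial, Finset.mul_sum]
  refine Finset.sum_congr rfl fun π hπ => ?_
  have h1 := two_mul_card_movedEdges (mem_edgeInvolutions.mp hπ).1
  have h2 := Finset.card_le_univ π.support
  obtain ⟨m, hm⟩ := Nat.exists_eq_add_of_le h2
  rw [hm, ← h1, Nat.add_sub_cancel_left, neg_pow z, pow_add (-1 : ℂ), pow_mul (-1 : ℂ) 2]
  simp
  ring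

/-- Stability of `sumDet` excludes roots in the upper half-plane, and conjugation excludes the lower
one. -/
lemma im_eq_zero_of_aeval_matchingPolynomial (hTG : T ≤ G) (hT : T.IsAcyclic) {z : ℂ}
    (hz : Polynomial.aeval z (matchingPolynomial G) = 0) : z.im = 0 := by
  have key : ∀ z : ℂ, Polynomial.aeval z (matchingPolynomial G) = 0 → ¬ 0 < z.im := by
    intro z hz him
    refine sumDet_ne_zero edgeVector (freeEdges G T) _
      (hasPosIm_add_smul_one (baseMatrix_isHermitian G T) him) ?_
    rw [sumDet_baseMatrix hTG hT, hz, mul_zero]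
  have h1 := key z hz
  have h2 := key (starRingEnd ℂ z) (by rw [Polynomial.aeval_conj, hz, map_zero])
  rw [Complex.conj_im] at h2
  linarith

lemma finite_root_norms (G : SimpleGraph V) :
    {r : ℝ | ∃ z : ℂ, Polynomial.aeval z (matchingPolynomial G) = 0 ∧ r = ‖z‖}.Finite := by
  refine (((matchingPolynomial G).rootSet_finite ℂ).image fun z => ‖z‖).subset ?_
  rintro r ⟨z, hz, rfl⟩
  refine ⟨z, ?_, rfl⟩
  rw [Polynomial.mem_rootSet]
  exact ⟨(matchingPolynomial_monic G).ne_zero, hz⟩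

lemma norm_le_rootRadius {z : ℂ} (hz : Polynomial.aeval z (matchingPolynomial G) = 0) :
    ‖z‖ ≤ rootRadius (matchingPolynomial G) :=
  le_csSup (finite_root_norms G).bddAbove ⟨z, hz, rfl⟩

lemma rootRadius_nonneg (p : Polynomial ℝ) : 0 ≤ rootRadius p := by
  refine Real.sSup_nonneg ?_
  rintro r ⟨z, _, rfl⟩
  exact norm_nonneg z

lemma aeval_ofReal_matchingPolynomial (x : ℝ) :
    Polynomial.aeval (x : ℂ) (matchingPolynomial G) = (((matchingPolynomial G).eval x : ℝ) : ℂ) := by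
  have := Polynomial.aeval_algebraMap_apply ℂ x (matchingPolynomial G)
  simpa [Polynomial.aeval_def] using this

lemma isGreatest_rootRadius [Nonempty V] (hTG : T ≤ G) (hT : T.IsAcyclic) :
    IsGreatest {x : ℝ | (matchingPolynomial G).IsRoot x} (rootRadius (matchingPolynomial G)) := by
  constructor
  · have hdeg : (matchingPolynomial G).degree ≠ 0 := by
      rw [matchingPolynomial_degree]
      exact_mod_cast Fintype.card_ne_zero
    obtain ⟨z₀, hz₀⟩ := IsAlgClosed.exists_aeval_eq_zero ℂ (matchingPolynomial G) hdeg
    have hne : {r : ℝ | ∃ z : ℂ, Polynomial.aeval z (matchingPolynomial G) = 0 ∧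
        r = ‖z‖}.Nonempty := ⟨_, z₀, hz₀, rfl⟩
    obtain ⟨z, hz, hr⟩ := hne.csSup_mem (finite_root_norms G)
    have him := im_eq_zero_of_aeval_matchingPolynomial hTG hT hz
    have hzre : z = (z.re : ℂ) := Complex.ext rfl (by simpa using him)
    change (matchingPolynomial G).eval (sSup _) = 0
    rw [hr]
    have hroot : Polynomial.aeval ((‖z‖ : ℝ) : ℂ) (matchingPolynomial G) = 0 := by
      rw [hzre, Complex.norm_real, Real.norm_eq_abs]
      -- A root of largest modulus is real, and the roots are symmetric under negation, so its
      -- modulus is a root too.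
      rcases abs_choice z.re with h | h
      · rw [h, ← hzre, hz]
      · rw [h, Complex.ofReal_neg, ← hzre, aeval_matchingPolynomial_neg, hz, mul_zero]
    rw [aeval_ofReal_matchingPolynomial] at hroot
    exact_mod_cast hroot
  · intro x hx
    have hx' : (matchingPolynomial G).eval x = 0 := hx
    have := norm_le_rootRadius (G := G) (z := (x : ℂ))
      (by rw [aeval_ofReal_matchingPolynomial, hx', Complex.ofReal_zero])
    rw [Complex.norm_real, Real.norm_eq_abs] at this
    exact (le_abs_self x).trans this

lemma eval_matchingPolynomial_pos [Nonempty V] {x : ℝ}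
    (hx : rootRadius (matchingPolynomial G) < x) : 0 < (matchingPolynomial G).eval x := by
  by_contra! hle
  have hdeg : 0 < (matchingPolynomial G).degree := by
    rw [matchingPolynomial_degree]
    exact_mod_cast Fintype.card_pos
  have htend := Polynomial.tendsto_atTop_of_leadingCoeff_nonneg (matchingPolynomial G) hdeg
    (by rw [(matchingPolynomial_monic G).leadingCoeff]; exact zero_le_one)
  obtain ⟨y, hy, hxy⟩ := ((htend.eventually (eventually_ge_atTop 0)).and
    (eventually_ge_atTop x)).exists
  obtain ⟨u, hu, hu0⟩ := intermediate_value_Icc hxy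
    (matchingPolynomial G).continuous.continuousOn ⟨hle, hy⟩
  have := norm_le_rootRadius (G := G) (z := (u : ℂ))
    (by rw [aeval_ofReal_matchingPolynomial]; exact_mod_cast hu0)
  rw [Complex.norm_real, Real.norm_eq_abs] at this
  linarith [le_abs_self u, hu.1]

end MatchingRoots

/-! ### Real and symmetric spectra -/

section Spectrum

variable {V : Type*} [Fintype V] [DecidableEq V] {G T : SimpleGraph V}

lemma mem_spectrum_iff_det (H : Matrix V V ℂ) (z : ℂ) :
    z ∈ spectrum ℂ H ↔ (z • (1 : Matrix V V ℂ) - H).det = 0 := by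
  rw [spectrum.mem_iff, Matrix.isUnit_iff_isUnit_det, isUnit_iff_ne_zero, not_not,
    Algebra.algebraMap_eq_smul_one]

lemma Matrix.IsHermitian.im_eq_zero_of_det {H : Matrix V V ℂ} (hH : H.IsHermitian) {z : ℂ}
    (hz : (z • (1 : Matrix V V ℂ) - H).det = 0) : z.im = 0 := by
  have key : ∀ z : ℂ, (z • (1 : Matrix V V ℂ) - H).det = 0 → ¬ 0 < z.im := by
    intro z hz him
    refine (hasPosIm_add_smul_one hH.neg him).det_ne_zero ?_
    rwa [neg_add_eq_sub]
  have h1 := key z hz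
  have h2 := key (star z) (by
    have := congrArg star hz
    rw [← det_conjTranspose, conjTranspose_sub, conjTranspose_smul, conjTranspose_one, hH.eq,
      star_zero] at this
    exact this)
  rw [Complex.star_def, Complex.conj_im] at h2
  linarith

/-- Conjugating by the diagonal ±1 matrix of a 2-colouring negates `H`. -/
lemma det_neg_smul_sub_of_isBipartite (hbip : G.IsBipartite) (hTG : T ≤ G)
    (σ : PartialOrientation G T) {z : ℂ}
    (hz : (z • (1 : Matrix V V ℂ) - σ.hermitianAdjMatrix).det = 0) :
    ((-z) • (1 : Matrix V V ℂ) - σ.hermitianAdjMatrix).det = 0 := by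
  obtain ⟨c⟩ := hbip
  let d : V → ℂ := fun v => if c v = 0 then 1 else -1
  have hd : ∀ v, d v * d v = 1 := by intro v; simp only [d]; split_ifs <;> simp
  have hconj : (-z) • (1 : Matrix V V ℂ) - σ.hermitianAdjMatrix =
      -(diagonal d * (z • (1 : Matrix V V ℂ) - σ.hermitianAdjMatrix) * diagonal d) := by
    ext u v
    rw [Matrix.neg_apply, Matrix.mul_diagonal, Matrix.diagonal_mul, Matrix.sub_apply,
      Matrix.sub_apply, Matrix.smul_apply, Matrix.smul_apply]
    by_cases huv : u = v
    · subst huv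
      rw [hermitianAdjMatrix_of_not_adj hTG σ (SimpleGraph.irrefl G), one_apply_eq]
      simp only [smul_eq_mul]
      linear_combination z * hd u
    · rw [one_apply_ne huv]
      by_cases hG : G.Adj u v
      · have hcol : d u * d v = -1 := by
          have hne : c u ≠ c v := c.valid hG
          simp only [d]
          split_ifs <;> first | omega | simp
        simp only [smul_zero]
        linear_combination -σ.hermitianAdjMatrix u v * hcol
      · rw [hermitianAdjMatrix_of_not_adj hTG σ hG]
        simp
  rw [hconj, det_neg, det_mul, det_mul, hz]
  simp

end Spectrum

theorem mainTheorem4 {V : Type*} [Fintype V] [DecidableEq V] (G T : SimpleGraph V)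
    (hG : G.Connected) (hbip : G.IsBipartite) (hTG : T ≤ G) (hT : T.IsTree) :
    IsGreatest {x : ℝ | (matchingPolynomial G).IsRoot x} (rootRadius (matchingPolynomial G)) ∧
      ∃ σ : PartialOrientation G T, σ.rho ≤ rootRadius (matchingPolynomial G) := by
  have := hG.nonempty
  refine ⟨isGreatest_rootRadius hTG hT.isAcyclic, ?_⟩
  by_contra! hc
  have hex : ∀ s : Sym2 V → Bool, ∃ x : ℝ, rootRadius (matchingPolynomial G) < x ∧
      ((x : ℂ) • (1 : Matrix V V ℂ) - (orient G T s).hermitianAdjMatrix).det = 0 := by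
    intro s
    by_contra! hs
    refine absurd (hc (orient G T s)) (not_lt.mpr (Real.sSup_le ?_ (rootRadius_nonneg _)))
    rintro r ⟨z, hz, rfl⟩
    by_contra! hlt
    rw [mem_spectrum_iff_det] at hz
    have him := (hermitianAdjMatrix_isHermitian (orient G T s)).im_eq_zero_of_det hz
    have hzre : z = (z.re : ℂ) := Complex.ext rfl (by simpa using him)
    refine hs _ hlt ?_
    rw [hzre, Complex.norm_real, Real.norm_eq_abs]
    rcases abs_choice z.re with h | h
    · rw [h, ← hzre, hz]
    · rw [h, Complex.ofReal_neg, ← hzre]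
      exact det_neg_smul_sub_of_isBipartite hbip hTG _ hz
  choose x hx hdet using hex
  -- The least of the chosen eigenvalues starts a ray that contains all of them, yet lies strictly
  -- beyond `rootRadius`, where the average is positive. The orientation `s` obtained below has no
  -- eigenvalue on this ray, although `x s` lies on it.
  obtain ⟨s₀, -, hmin⟩ := Finset.exists_min_image Finset.univ x ⟨fun _ => true, Finset.mem_univ _⟩
  have hshift : ∀ t : ℝ, baseMatrix G T + (x s₀ : ℂ) • (1 : Matrix V V ℂ) +
      (t : ℂ) • (1 : Matrix V V ℂ) =
      baseMatrix G T + ((x s₀ + t : ℝ) : ℂ) • (1 : Matrix V V ℂ) := by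
    intro t
    rw [add_assoc, ← add_smul, Complex.ofReal_add]
  obtain ⟨s, hs⟩ := exists_choice_det_pos edgeVector (freeEdges G T)
    (baseMatrix G T + (x s₀ : ℂ) • (1 : Matrix V V ℂ))
    (isHermitian_add_real_smul_one (baseMatrix_isHermitian G T) _) (by
      intro t ht
      rw [shiftVal, hshift, sumDet_baseMatrix hTG hT.isAcyclic, aeval_ofReal_matchingPolynomial]
      have h1 : (0 : ℝ) < Fintype.card (Sym2 V → Bool) := by exact_mod_cast Fintype.card_pos
      have h2 := eval_matchingPolynomial_pos (G := G)
        (lt_of_lt_of_le (hx s₀) (le_add_of_nonneg_right ht))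
      have h3 := mul_pos h1 h2
      rw [← Complex.ofReal_natCast, ← Complex.ofReal_mul, Complex.ofReal_re]
      exact h3)
  have h := hs (x s - x s₀) (sub_nonneg.mpr (hmin s (Finset.mem_univ _)))
  rw [← add_sub_right_comm, hshift, add_sub_right_comm, baseMatrix_sub, neg_add_eq_sub,
    add_sub_cancel, hdet s] at h
  exact lt_irrefl _ h
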